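/- Let $\mathcal A$ be a countably infinite alphabet. Terms are built from the variables in $\mathcal A$ by an associative concatenation and a unary operation $^*$. An involution semigroup $(S,{}^*)$ is a semigroup $S$ with a unary operation $^*$ satisfying $$(x^*)^*\approx x,\qquad (xy)^*\approx y^*x^*. \tag{1}$$ An identity is deducible from a set $\Sigma$ of identities if its two sides are joined by a finite sequence of terms in which consecutive terms differ by replacing one subterm $\mathbf p\varphi$ by $\mathbf q\varphi$, for some substitution $\varphi$ and some identity $\mathbf p\approx\mathbf q$ or $\mathbf q\approx\mathbf p$ of $\Sigma$. A set $\Sigma$ of identities is an identity basis for $(S,{}^*)$ if $(S,{}^*)$ satisfies every identity in $\Sigma$ and every identity satisfied by $(S,{}^*)$ is deducible from $\Sigma$; $(S,{}^*)$ is finitely based if it has a finite identity basis. Let $(B_0,{}^*)$ be the involution semigroup on $\{1,2,3,4\}$ in which $1\cdot3=4\cdot1=1$, $3\cdot3=3$, $4\cdot4=4$, all other products are $2$, and $^*$ interchanges $3$ and $4$ and fixes $1$ and $2$. **Theorem.** The identities (1) together with $$xx^*x\approx 0,\qquad xyx^*\approx xy^*x^*,\qquad x\mathsf Tx^*y\approx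 y^*x\mathsf Tx^*,$$ $$x^2\mathsf Tx^*\approx x\mathsf Tx^*\approx x\mathsf T(x^*)^2,\qquad x^2\approx x^3,\qquad xyx\approx yxy\approx xyxy,$$ $$xxyy\approx yyxx$$ constitute an identity basis for $(B_0,{}^*)$. Here $xx^*x\approx0$ stands for the identities $xx^*xy\approx xx^*x\approx yxx^*x$, and each identity containing the symbol $\mathsf T$ stands for two identities: the one in which $\mathsf T$ is a further variable and the one in which $\mathsf T$ is deleted. In particular, the involution semigroup $(B_0,{}^*)$ of order four is finitely based. -/

import Mathlib

namespace InvSemi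

/-- Terms over the countably infinite alphabet `{var n | n : ℕ}`, built with a binary
multiplication and a unary star.  Terms are read up to associativity of multiplication
(concatenation); this is taken care of in `Deducible`. -/
inductive Term : Type
  | var : ℕ → Term
  | mul : Term → Term → Term
  | star : Term → Term

instance : Mul Term := ⟨Term.mul⟩

instance : Star Term := ⟨Term.star⟩

/-- The term obtained from a term by the substitution `φ`. -/
def Term.subst (φ : ℕ → Term) : Term → Term
  | .var n => φ n
  | .mul s t => .mul (s.subst φ) (t.subst φ)
  | .star s => .star (s.subst φ)

/-- The value of a term in a set with a multiplication and a star under an assignment `φ`. -/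
def Term.eval {S : Type*} [Mul S] [Star S] (φ : ℕ → S) : Term → S
  | .var n => φ n
  | .mul s t => s.eval φ * t.eval φ
  | .star s => Star.star (s.eval φ)

/-- An identity `lhs ≈ rhs`. -/
structure Identity : Type where
  lhs : Term
  rhs : Term

/-- `t` results from `s` by replacing one subterm of the form `p φ` by `q φ`, where `p ≈ q` is
an identity of `Γ` and `φ` is a substitution. -/
inductive Rewrites (Γ : Set Identity) : Term → Term → Prop
  | inst {i : Identity} (hi : i ∈ Γ) (φ : ℕ → Term) :
      Rewrites Γ (i.lhs.subst φ) (i.rhs.subst φ)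
  | mulLeft {s t : Term} (r : Term) : Rewrites Γ s t → Rewrites Γ (.mul s r) (.mul t r)
  | mulRight {s t : Term} (r : Term) : Rewrites Γ s t → Rewrites Γ (.mul r s) (.mul r t)
  | star {s t : Term} : Rewrites Γ s t → Rewrites Γ (.star s) (.star t)

/-- The variables used to write down identities. -/
abbrev x : Term := .var 0

/-- The variables used to write down identities. -/
abbrev y : Term := .var 1

/-- The variables used to write down identities. -/
abbrev z : Term := .var 2

/-- The associative law. -/
def assocLaw : Identity := ⟨(x * y) * z, x * (y * z)⟩

/-- The identity `i` is deducible from `Γ`: there is a finite sequence of terms from `i.lhs` to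
`i.rhs` in which consecutive terms differ by an application, in either direction, of an identity
of `Γ` or of the associative law. -/
def Deducible (Γ : Set Identity) (i : Identity) : Prop :=
  Relation.EqvGen (Rewrites (insert assocLaw Γ)) i.lhs i.rhs

/-- `S` satisfies the identity `i`. -/
def Satisfies (S : Type*) [Mul S] [Star S] (i : Identity) : Prop :=
  ∀ φ : ℕ → S, i.lhs.eval φ = i.rhs.eval φ

/-- `Γ` is an identity basis of the involution semigroup `S` (in Mathlib, `StarMul` says that
`star` is an involution with `star (a * b) = star b * star a`): `S` satisfies every identity of
`Γ`, and every identity of `S` is deducible from `Γ`. -/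
def IsIdentityBasis (S : Type*) [Semigroup S] [StarMul S] (Γ : Set Identity) : Prop :=
  (∀ i ∈ Γ, Satisfies S i) ∧ ∀ i : Identity, Satisfies S i → Deducible Γ i

/-- An involution semigroup is finitely based if it has a finite identity basis. -/
def FinitelyBased (S : Type*) [Semigroup S] [StarMul S] : Prop :=
  ∃ Γ : Set Identity, Γ.Finite ∧ IsIdentityBasis S Γ

/-- The underlying set `{1, 2, 3, 4}` of the involution semigroup `B₀`. -/
inductive B0 : Type
  | e1 | e2 | e3 | e4

namespace B0

/-- The multiplication of `B₀`; its table has the rows `2212`, `2222`, `2232`, `1224`. -/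
protected def mul : B0 → B0 → B0
  | e1, e3 => e1
  | e3, e3 => e3
  | e4, e1 => e1
  | e4, e4 => e4
  | _, _ => e2

/-- The involution of `B₀`, which interchanges `3` and `4` and fixes `1` and `2`. -/
protected def star : B0 → B0
  | e1 => e1
  | e2 => e2
  | e3 => e4
  | e4 => e3

instance : Semigroup B0 where
  mul := B0.mul
  mul_assoc := by
    intro a b c
    cases a <;> cases b <;> cases c <;> rfl

instance : StarMul B0 where
  star := B0.star
  star_involutive := by
    intro a
    cases a <;> rfl
  star_mul := by
    intro a b
    cases a <;> cases b <;> rfl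

end B0

/-- `(x*)* ≈ x` and `(xy)* ≈ y*x*`. -/
def involutionIdentities : Set Identity :=
  {⟨star (star x), x⟩,
   ⟨star (x * y), star y * star x⟩}

/-- The identities
* `x x* x ≈ 0`, that is, `x x* x y ≈ x x* x ≈ y x x* x` with a further variable `y`;
* `x y x* ≈ x y* x*`;
* `x T x* y ≈ y* x T x*`;
* `x² T x* ≈ x T x* ≈ x T (x*)²`;
* `x² ≈ x³`, `x y x ≈ y x y ≈ x y x y`.

An identity written with `T` stands for two identities: the one in which `T` is a variable (here
`z`), and the one in which `T` is deleted. -/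
def mixedIdentities : Set Identity :=
  {⟨x * star x * x * y, x * star x * x⟩,
   ⟨x * star x * x, y * x * star x * x⟩,
   ⟨x * y * star x, x * star y * star x⟩,
   ⟨x * z * star x * y, star y * x * z * star x⟩,
   ⟨x * star x * y, star y * x * star x⟩,
   ⟨x * x * z * star x, x * z * star x⟩,
   ⟨x * x * star x, x * star x⟩,
   ⟨x * z * star x, x * z * star x * star x⟩,
   ⟨x * star x, x * star x * star x⟩,
   ⟨x * x, x * x * x⟩,
   ⟨x * y * x, y * x * y⟩,
   ⟨y * x * y, x * y * x * y⟩}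

/-- `x x y y ≈ y y x x`. -/
def squaresCommute : Identity := ⟨x * x * y * y, y * y * x * x⟩

/-- The proposed identity basis of `(B₀, *)`. -/
def basisB0 : Set Identity :=
  involutionIdentities ∪ mixedIdentities ∪ {squaresCommute}

end InvSemi

/-!
The letters are the variables and their stars, and moving all stars to the variables turns a term
into a word in the letters.  In `B0` the elements `3` and `4` are orthogonal idempotents, and `1`
is a nilpotent between them.  Hence a word has value `4` exactly when all its letters do, and it has
value `1` exactly when it is `p l q` where the letter `l` has value `1`, those of `p` have value
`4` and those of `q` have value `3`.  So the identities of `B0` preserve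

* the set of letters of a word, provided that no letter occurs with its star (`mem_of_holdsB0`);
* the *pairs* of a word: a variable that occurs once, in `w = p l q`, with the set of letters
  of `p` and stars of letters of `q`, provided that this set contains no letter with its star
  (`Pair.of_holdsB0`).

It remains to show that words with the same invariants are equal modulo the identities.

*Words without a letter and its star.*  The identities give `(xy)² = x²y²`, that squares commute,
and `xyx = x²y²`, so that a word without a cut (a letter occurring once whose two sides have no
letter in common) is the product of the squares of its letters, in any order
(`val_eq_sq_of_no_cut`).  A word with a cut is split there, and induction on the length shows that
words with the same letters and the same cuts are equal (`weq_of_cutsLe`).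

*Words with a letter and its star.*  The squares commute, so `x x*` is a zero.  Letters outside a
factor `x T x*` can be merged with `x`, which gives `C² T C*²` for a word `C`, where `C²` depends
only on the set of letters of `C` (`weq_frame_of_pair`).  As long as possible, letters of `T` are
moved to `C`.  The result is a zero or a reduced frame `C² B C*²`: here no variable is in both
`C` and `B`, no letter occurs with its star, and the first and the last letter of `B` occur only
once (`mixed_reduce`).  The pairs of a reduced frame determine the set of letters of `C`, and `B`
up to replacing `B` by `B*`, which does not change the frame (`weq_of_reduced`).

Everything is computed in semigroups with a unit adjoined, so that words may be empty.  Applied to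
the terms modulo deducibility, equality of the values of two words is deducibility of the identity
(`deducible_of_weq`); applied to `B0`, it shows that each reduction keeps the invariants.
-/

namespace InvSemi

/-! ### The identities in a monoid -/

/-- A monoid with involution that behaves like a semigroup satisfying `basisB0` with a unit
adjoined.  Only the variable `T`, and variables for which the identity remains true, may take the
value `1`; so an identity with `T` and the one with `T` deleted become one law. -/
class Model (M : Type) [Monoid M] [StarMul M] : Prop where
  mul_ne_one : ∀ a b : M, a ≠ 1 → a * b ≠ 1
  zero_mul : ∀ a b : M, a ≠ 1 → a * star a * a * b = a * star a * a
  mul_zero : ∀ a b : M, a ≠ 1 → a * star a * a = b * a * star a * a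
  star_middle : ∀ a b : M, a ≠ 1 → a * b * star a = a * star b * star a
  shift : ∀ a b t : M, a ≠ 1 → a * t * star a * b = star b * a * t * star a
  sq_left : ∀ a t : M, a * a * t * star a = a * t * star a
  sq_right : ∀ a t : M, a * t * star a = a * t * star a * star a
  cube : ∀ a : M, a * a = a * a * a
  aba : ∀ a b : M, a ≠ 1 → b ≠ 1 → a * b * a = b * a * b
  abab : ∀ a b : M, a ≠ 1 → b ≠ 1 → b * a * b = a * b * a * b
  sq_comm : ∀ a b : M, a * a * b * b = b * b * a * a

namespace Model

variable {M : Type} [Monoid M] [StarMul M] [Model M]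

theorem sq_mul_sq_comm (a b : M) : a ^ 2 * b ^ 2 = b ^ 2 * a ^ 2 := by
  simpa [pow_two, mul_assoc] using sq_comm a b

theorem sq_mul_self (a : M) : a ^ 2 * a = a ^ 2 := by
  simpa [pow_two, mul_assoc] using (cube a).symm

theorem self_mul_sq (a : M) : a * a ^ 2 = a ^ 2 := by
  simpa [pow_two, mul_assoc] using (cube a).symm

theorem sq_mul_sq (a : M) : a ^ 2 * a ^ 2 = a ^ 2 := by
  rw [pow_two a, ← mul_assoc, ← cube, ← cube]

theorem sq_sq (a : M) : (a ^ 2) ^ 2 = a ^ 2 := by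
  rw [pow_two (a ^ 2), sq_mul_sq]

/-- `a * b * a` is the zero of the semigroup generated by `a` and `b`, and so is
`a ^ 2 * b ^ 2`. -/
theorem aba_eq (a b : M) (ha : a ≠ 1) : a * b * a = a ^ 2 * b ^ 2 := by
  by_cases hb : b = 1
  · simp [hb, pow_two]
  have h1 := aba a b ha hb
  have h2 := abab a b ha hb
  have h2' := abab b a hb ha
  -- `a * b * a` absorbs `a` and `b`
  have r1 : (a * b * a) * b = a * b * a := by rw [← h2, h1]
  have l1 : b * (a * b * a) = a * b * a := by
    rw [show b * (a * b * a) = b * a * b * a by simp only [mul_assoc], ← h2']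
  have l2 : a * (a * b * a) = a * b * a := by
    rw [h1, show a * (b * a * b) = a * b * a * b by simp only [mul_assoc], ← h2]
  have r2 : (a * b * a) * a = a * b * a := by
    rw [h1, ← h2']; exact h1
  -- so does `a ^ 2 * b ^ 2`
  have s1 : (a ^ 2 * b ^ 2) * a = a ^ 2 * b ^ 2 := by
    rw [sq_mul_sq_comm, mul_assoc, sq_mul_self]
  have s2 : (a ^ 2 * b ^ 2) * b = a ^ 2 * b ^ 2 := by
    rw [mul_assoc, sq_mul_self]
  calc a * b * a = (a ^ 2 * b ^ 2) * (a * b * a) := by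
        simp only [pow_two, mul_assoc a b a] at *
        simp only [mul_assoc, l1, l2]
    _ = a ^ 2 * b ^ 2 := by
        rw [← mul_assoc, ← mul_assoc, s1, s2, s1]

theorem mul_sq (a b : M) : (a * b) ^ 2 = a ^ 2 * b ^ 2 := by
  by_cases ha : a = 1
  · simp [ha]
  by_cases hb : b = 1
  · simp [hb]
  rw [← aba_eq a b ha, aba a b ha hb, abab a b ha hb, pow_two, mul_assoc (a * b)]

/-- If `c ^ 2` absorbs `t ^ 2`, then `x` is squared between `c ^ 2` and `t`, which disappears. -/
theorem sq_mul_aba (c x t : M) (ht : t ≠ 1) (h : c ^ 2 * t ^ 2 = c ^ 2) :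
    c ^ 2 * x * t = c ^ 2 * x ^ 2 := by
  calc c ^ 2 * x * t = c ^ 2 * t * (t * x * t) := by
        conv_lhs => rw [← h]
        simp only [pow_two, mul_assoc]
    _ = c ^ 2 * t ^ 2 * x ^ 2 := by
        rw [aba_eq t x ht, mul_assoc, ← mul_assoc t, self_mul_sq, mul_assoc]
    _ = c ^ 2 * x ^ 2 := by rw [h]

/-- An element times its star is a zero.  The identity `x x* x ≈ 0` alone does not give this; the
commutation of the squares of `a` and `star a` does, since it makes `a` and `star a` commute. -/
theorem mul_star_mul (a b : M) (ha : a ≠ 1) : a * star a * b = a * star a := by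
  have e : a * star a = a * star a * a * star a := by
    have h1 := sq_left a (1 : M)
    have h2 := sq_right a (1 : M)
    have h3 := sq_comm a (star a)
    simp only [mul_one] at h1 h2
    have h4 : a * star a = star a * star a * a * a := by
      rw [← h3, h1, ← h2]
    have h5 : a * star a = star a * a := by
      have := congrArg star h4
      have h6 := sq_left (star a) (1 : M)
      have h7 := sq_right (star a) (1 : M)
      simp only [mul_one, star_star] at h6 h7
      rw [h4, h6, ← h7]
    calc a * star a = a * (a * star a) * star a := by
          rw [← mul_assoc, h1, ← h2]
      _ = a * (star a * a) * star a := by rw [← h5]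
      _ = _ := by simp only [mul_assoc]
  have z := fun c => zero_mul a c ha
  rw [e, z (star a), z]

theorem mul_mul_star (a b : M) (ha : a ≠ 1) : b * (a * star a) = a * star a := by
  have := congrArg star (mul_star_mul a (star b) ha)
  simpa [mul_assoc] using this

theorem mul_star_eq (a b : M) (ha : a ≠ 1) (hb : b ≠ 1) : a * star a = b * star b := by
  rw [← mul_star_mul a (b * star b) ha, mul_mul_star b _ hb]

/-- A factor in front of `a * t * star a` can be merged with `a`. -/
theorem mul_conj (d a t : M) (ha : a ≠ 1) :
    d * a * t * star a = (d * a) ^ 2 * t * star ((d * a) ^ 2) := by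
  have sh : ∀ d t : M, d * (a * t * star a) = a * t * star a * star d := by
    intro d t
    rw [shift a (star d) t ha, star_star]; simp only [mul_assoc]
  have q : ∀ t : M, a * t * star a = a ^ 2 * t * star a := by
    intro t; rw [← sq_left]; simp only [pow_two]
  -- the factor in front is idempotent
  have com : ∀ d e t : M, d * (e * (a * t * star a)) = e * (d * (a * t * star a)) := by
    intro d e t
    rw [sh e t, ← mul_assoc, sh d t, mul_assoc, ← star_mul, ← sh, mul_assoc, sh d t]
  have idem : ∀ t : M, d * (a * t * star a) = d ^ 2 * (a * t * star a) := by
    intro t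
    calc d * (a * t * star a) = d * (a * (a * t * star a)) := by
          rw [q]; simp only [pow_two, mul_assoc]
          congr 1
          have := q t
          simp only [pow_two, mul_assoc] at this
          rw [← this]
          exact this
      _ = a * d * a * (t * star a) := by
          rw [com]; simp only [mul_assoc]
      _ = d ^ 2 * (a ^ 2 * t * star a) := by
          rw [aba_eq a d ha, sq_mul_sq_comm]; simp only [mul_assoc]
      _ = _ := by rw [← q]
  have hda : d * a * t * star a = (d * a) * t * star (d * a) := by
    calc d * a * t * star a = d * (a * t * star a) := by simp only [mul_assoc]
      _ = d * (d * (a * t * star a)) := by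
          have := idem t
          simp only [pow_two, mul_assoc] at this ⊢
          exact this
      _ = _ := by rw [sh d t, star_mul]; simp only [mul_assoc]
  rw [hda]
  have h1 := sq_left (d * a) t
  have h2 := sq_right (d * a) t
  calc d * a * t * star (d * a) = d * a * t * star (d * a) * star (d * a) := h2
    _ = _ := by rw [← h1]; simp only [pow_two, star_mul, mul_assoc]

/-- A square next to `c ^ 2` in `c ^ 2 * t * star (c ^ 2)` can be merged with `c`. -/
theorem sq_conj (c s t : M) (hc : c ≠ 1) :
    c ^ 2 * (s ^ 2 * t) * star (c ^ 2) = (c * s) ^ 2 * t * star ((c * s) ^ 2) := by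
  have hc2 : c ^ 2 ≠ 1 := by rw [pow_two]; exact mul_ne_one c c hc
  have := mul_conj (s ^ 2) (c ^ 2) t hc2
  rw [mul_sq c s, sq_mul_sq_comm c s]
  rw [mul_sq, sq_sq, sq_sq] at this
  rw [← this, ← sq_mul_sq_comm]; simp only [mul_assoc]

theorem star_conj (c t : M) (hc : c ≠ 1) :
    c ^ 2 * t * star (c ^ 2) = c ^ 2 * star t * star (c ^ 2) :=
  star_middle _ _ (by rw [pow_two]; exact mul_ne_one c c hc)

end Model

/-! ### Words -/

/-- A variable `(n, false)` or its star `(n, true)`. -/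
abbrev Letter := ℕ × Bool

/-- The star of a letter. -/
def inv (l : Letter) : Letter := (l.1, !l.2)

@[simp] theorem inv_inv (l : Letter) : inv (inv l) = l := by simp [inv]

@[simp] theorem inv_fst (l : Letter) : (inv l).1 = l.1 := rfl

theorem inv_ne (l : Letter) : inv l ≠ l := by
  intro h; have := congrArg Prod.snd h; simp [inv] at this

theorem eq_or_eq_inv {l m : Letter} (h : l.1 = m.1) : l = m ∨ l = inv m := by
  rcases l with ⟨n, b⟩; rcases m with ⟨k, c⟩
  simp only at h; subst h
  cases b <;> cases c <;> simp [inv]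

/-- The star of a word: the reversed word of the starred letters. -/
def winv (w : List Letter) : List Letter := (w.map inv).reverse

@[simp] theorem winv_winv (w : List Letter) : winv (winv w) = w := by
  simp [winv, Function.comp_def]

@[simp] theorem mem_winv {l : Letter} {w : List Letter} : l ∈ winv w ↔ inv l ∈ w := by
  simp only [winv, List.mem_reverse, List.mem_map]
  constructor
  · rintro ⟨a, ha, rfl⟩; simpa
  · intro h; exact ⟨_, h, by simp⟩

@[simp] theorem winv_append (u v : List Letter) : winv (u ++ v) = winv v ++ winv u := by
  simp [winv]

@[simp] theorem winv_cons (l : Letter) (v : List Letter) :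
    winv (l :: v) = winv v ++ [inv l] := by
  simp [winv]

@[simp] theorem winv_nil : winv [] = [] := rfl

@[simp] theorem length_winv (w : List Letter) : (winv w).length = w.length := by simp [winv]

section Value

variable {M : Type} [Monoid M] [StarMul M]

/-- The value of a letter under an assignment of the variables. -/
def letterVal (φ : ℕ → M) (l : Letter) : M := if l.2 then star (φ l.1) else φ l.1

/-- The value of a word under an assignment of the variables. -/
def val (φ : ℕ → M) (w : List Letter) : M := (w.map (letterVal φ)).prod

variable (φ : ℕ → M)

theorem letterVal_inv (l : Letter) : letterVal φ (inv l) = star (letterVal φ l) := by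
  rcases l with ⟨n, _ | _⟩ <;> simp [letterVal, inv]

@[simp] theorem val_nil : val φ [] = 1 := rfl

@[simp] theorem val_append (u v : List Letter) : val φ (u ++ v) = val φ u * val φ v := by
  simp [val]

theorem val_cons (l : Letter) (v : List Letter) :
    val φ (l :: v) = letterVal φ l * val φ v := by
  simp [val]

@[simp] theorem val_winv (w : List Letter) : val φ (winv w) = star (val φ w) := by
  induction w with
  | nil => simp
  | cons l w ih => simp [val_cons, ih, letterVal_inv]

theorem letterVal_ne_one (hφ : ∀ n, φ n ≠ 1) (l : Letter) : letterVal φ l ≠ 1 := by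
  rcases l with ⟨n, _ | _⟩
  · simpa [letterVal] using hφ n
  · intro h
    apply hφ n
    simpa [letterVal] using congrArg star h

theorem val_ne_one [Model M] (hφ : ∀ n, φ n ≠ 1) {w : List Letter} (hw : w ≠ []) :
    val φ w ≠ 1 := by
  cases w with
  | nil => exact absurd rfl hw
  | cons l w =>
    rw [val_cons]; exact Model.mul_ne_one _ _ (letterVal_ne_one φ hφ l)

theorem val_sq_mem [Model M] {l : Letter} {w : List Letter} (h : l ∈ w) :
    val φ w ^ 2 * letterVal φ l ^ 2 = val φ w ^ 2 := by
  induction w with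
  | nil => simp at h
  | cons m w ih =>
    rw [val_cons, Model.mul_sq]
    rcases List.mem_cons.1 h with rfl | h
    · rw [Model.sq_mul_sq_comm, mul_assoc, Model.sq_mul_sq]
    · rw [mul_assoc, ih h]

theorem val_sq_subset [Model M] {u v : List Letter} (h : ∀ l ∈ u, l ∈ v) :
    val φ v ^ 2 * val φ u ^ 2 = val φ v ^ 2 := by
  induction u with
  | nil => simp
  | cons m u ih =>
    rw [val_cons, Model.mul_sq, ← mul_assoc, val_sq_mem φ (h m (by simp)),
      ih fun l hl => h l (by simp [hl])]

/-- The square of a word depends only on the letters that occur in it. -/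
theorem val_sq_congr [Model M] {u v : List Letter} (h : ∀ l, l ∈ u ↔ l ∈ v) :
    val φ u ^ 2 = val φ v ^ 2 := by
  calc val φ u ^ 2 = val φ u ^ 2 * val φ v ^ 2 := (val_sq_subset φ fun l => (h l).2).symm
    _ = val φ v ^ 2 * val φ u ^ 2 := Model.sq_mul_sq_comm _ _
    _ = val φ v ^ 2 := val_sq_subset φ fun l => (h l).1

end Value

/-- The identity `u ≈ v` between words follows from the identities of `basisB0`. -/
def WEq (u v : List Letter) : Prop :=
  ∀ (M : Type) [Monoid M] [StarMul M] [Model M] (φ : ℕ → M), (∀ n, φ n ≠ 1) →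
    val φ u = val φ v

theorem WEq.refl (u : List Letter) : WEq u u := fun _ _ _ _ _ _ => rfl

theorem WEq.symm {u v : List Letter} (h : WEq u v) : WEq v u :=
  fun M _ _ _ φ hφ => (h M φ hφ).symm

theorem WEq.trans {u v w : List Letter} (h : WEq u v) (k : WEq v w) : WEq u w :=
  fun M _ _ _ φ hφ => (h M φ hφ).trans (k M φ hφ)

theorem WEq.append {u v u' v' : List Letter} (h : WEq u v) (k : WEq u' v') :
    WEq (u ++ u') (v ++ v') := by
  intro M _ _ _ φ hφ
  rw [val_append, val_append, h M φ hφ, k M φ hφ]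


/-! ### Words determined by their cuts -/

/-- In the word `p ++ l :: q` the letter `l` is a cut: it occurs nowhere else, and the words on
its two sides have no letter in common.  A letter and its star count as unrelated here. -/
def IsCut (p : List Letter) (l : Letter) (q : List Letter) : Prop :=
  l ∉ p ∧ l ∉ q ∧ ∀ m ∈ p, m ∉ q

/-- Every cut of `u` occurs in `v`, with the same letters on its left and on its right. -/
def CutsLe (u v : List Letter) : Prop :=
  ∀ p l q, u = p ++ l :: q → IsCut p l q →
    ∃ p' q', v = p' ++ l :: q' ∧ (∀ m, m ∈ p ↔ m ∈ p') ∧ ∀ m, m ∈ q ↔ m ∈ q'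

theorem Model.eq_sq_mul {M : Type} [Monoid M] [StarMul M] [Model M] {a b : M}
    (ha : a = a ^ 2) (hb : b = b ^ 2) : a * b = (a * b) ^ 2 := by
  rw [Model.mul_sq, ← ha, ← hb]

/-- A word without cuts equals its square.  The prefix `P`, which is already known to equal its
square, grows until it is the whole word. -/
theorem val_eq_sq_of_no_cut {M : Type} [Monoid M] [StarMul M] [Model M] (φ : ℕ → M)
    (hφ : ∀ n, φ n ≠ 1) (n : ℕ) : ∀ P R : List Letter, R.length ≤ n →
    (∀ p l q, P ++ R = p ++ l :: q → ¬ IsCut p l q) → val φ P = val φ P ^ 2 →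
    val φ (P ++ R) = val φ (P ++ R) ^ 2 := by
  induction n with
  | zero =>
    intro P R hR _ hP
    obtain rfl : R = [] := List.eq_nil_of_length_eq_zero (by omega)
    simpa using hP
  | succ n ih =>
    intro P R hR hc hP
    cases R with
    | nil => simpa using hP
    | cons l R =>
      have hsq : ∀ a : M, a ^ 2 = (a ^ 2) ^ 2 := fun a => (Model.sq_sq a).symm
      -- a longer prefix that equals its square suffices
      have key : ∀ X Y, l :: R = X ++ Y → X ≠ [] → val φ (P ++ X) = val φ (P ++ X) ^ 2 →
          val φ (P ++ l :: R) = val φ (P ++ l :: R) ^ 2 := by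
        intro X Y hXY hX hPX
        have hlen := congrArg List.length hXY
        have : 0 < X.length := List.length_pos_iff.2 hX
        simp only [List.length_cons, List.length_append] at hlen hR
        rw [hXY, ← List.append_assoc]
        refine ih (P ++ X) Y (by omega) ?_ hPX
        rw [List.append_assoc, ← hXY]
        exact hc
      have absorb : ∀ t ∈ P, ∀ x : M,
          val φ P * x * letterVal φ t = (val φ P * x * letterVal φ t) ^ 2 := by
        intro t ht x
        have h1 := Model.sq_mul_aba (val φ P) x _ (letterVal_ne_one φ hφ t) (val_sq_mem φ ht)
        rw [← hP] at h1
        rw [h1]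
        exact Model.eq_sq_mul hP (hsq x)
      by_cases h1 : l ∈ P
      · refine key [l] R rfl (by simp) ?_
        simpa [val_cons] using absorb l h1 1
      by_cases h2 : l ∈ R
      · obtain ⟨A, B, rfl⟩ := List.append_of_mem h2
        refine key (l :: (A ++ [l])) B (by simp) (by simp) ?_
        rw [val_append]
        refine Model.eq_sq_mul hP ?_
        have := Model.aba_eq (letterVal φ l) (val φ A) (letterVal_ne_one φ hφ l)
        simp only [val_cons, val_append, val_nil, mul_one, ← mul_assoc]
        rw [this]
        exact Model.eq_sq_mul (hsq _) (hsq _)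
      by_cases h3 : ∀ m ∈ P, m ∉ R
      · exact absurd ⟨h1, h2, h3⟩ (hc P l R rfl)
      push Not at h3
      obtain ⟨t, ht, htR⟩ := h3
      obtain ⟨A, B, rfl⟩ := List.append_of_mem htR
      refine key (l :: (A ++ [t])) B (by simp) (by simp) ?_
      have := absorb t ht (val φ (l :: A))
      simpa [val_cons, mul_assoc] using this

theorem CutsLe.left {p q p' q' : List Letter} {l : Letter}
    (h : CutsLe (p ++ l :: q) (p' ++ l :: q')) (hc : IsCut p l q)
    (hp : ∀ m, m ∈ p ↔ m ∈ p') (hq : ∀ m, m ∈ q ↔ m ∈ q') : CutsLe p p' := by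
  rintro a m b rfl ⟨hc1, hc2, hc3⟩
  obtain ⟨h1, h2, h3⟩ := hc
  obtain ⟨a', b', he, ha, hb⟩ := h a m (b ++ l :: q) (by simp) (by
    refine ⟨hc1, ?_, ?_⟩ <;> grind)
  have hml : m ≠ l := by grind
  have hmq : m ∉ q' := by grind
  rcases List.append_eq_append_iff.1 he with ⟨as, rfl, h5⟩ | ⟨bs, rfl, h5⟩
  · exfalso
    have : m ∈ l :: q' := by rw [h5]; simp
    grind
  · cases bs with
    | nil => simp at h5; exact absurd h5.1 (by grind)
    | cons k bs =>
      simp only [List.cons_append, List.cons.injEq] at h5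
      obtain ⟨rfl, rfl⟩ := h5
      refine ⟨a', bs, rfl, ha, ?_⟩
      intro k
      have := hb k
      have := hp k
      grind

theorem CutsLe.right {p q p' q' : List Letter} {l : Letter}
    (h : CutsLe (p ++ l :: q) (p' ++ l :: q')) (hc : IsCut p l q)
    (hp : ∀ m, m ∈ p ↔ m ∈ p') (hq : ∀ m, m ∈ q ↔ m ∈ q') : CutsLe q q' := by
  rintro a m b rfl ⟨hc1, hc2, hc3⟩
  obtain ⟨h1, h2, h3⟩ := hc
  obtain ⟨a', b', he, ha, hb⟩ := h (p ++ l :: a) m b (by simp) (by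
    refine ⟨?_, ?_, ?_⟩ <;> grind)
  have hml : m ≠ l := by grind
  have hmp : m ∉ p' := by grind
  rcases List.append_eq_append_iff.1 he with ⟨as, rfl, h5⟩ | ⟨bs, rfl, h5⟩
  · cases as with
    | nil => simp at h5; exact absurd h5.1.symm (by grind)
    | cons k as =>
      simp only [List.cons_append, List.cons.injEq] at h5
      obtain ⟨rfl, rfl⟩ := h5
      refine ⟨as, b', rfl, ?_, hb⟩
      intro k
      have := ha k
      grind
  · exfalso
    cases bs with
    | nil => simp at h5; exact hml h5.1
    | cons k bs => simp at h5; exact hmp (by simp [h5.1])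

theorem weq_of_cutsLe (n : ℕ) : ∀ u v : List Letter, u.length ≤ n →
    (∀ m, m ∈ u ↔ m ∈ v) → CutsLe u v → CutsLe v u → WEq u v := by
  induction n with
  | zero =>
    intro u v hu h _ _
    obtain rfl : u = [] := List.eq_nil_of_length_eq_zero (by omega)
    obtain rfl : v = [] := List.eq_nil_iff_forall_not_mem.2 fun m hm => by simpa using (h m).2 hm
    exact WEq.refl _
  | succ n ih =>
    intro u v hu h h1 h2
    by_cases hc : ∃ p l q, u = p ++ l :: q ∧ IsCut p l q
    · obtain ⟨p, l, q, rfl, hc⟩ := hc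
      obtain ⟨p', q', rfl, hp, hq⟩ := h1 p l q rfl hc
      have hc' : IsCut p' l q' := by
        obtain ⟨a, b, c⟩ := hc
        refine ⟨by grind, by grind, by grind⟩
      have hp' := fun m => (hp m).symm
      have hq' := fun m => (hq m).symm
      simp only [List.length_append, List.length_cons] at hu
      exact (ih p p' (by omega) hp (h1.left hc hp hq) (h2.left hc' hp' hq')).append
        (WEq.append (WEq.refl [l])
          (ih q q' (by omega) hq (h1.right hc hp hq) (h2.right hc' hp' hq')))
    · push Not at hc
      have hc' : ∀ p l q, v = p ++ l :: q → ¬ IsCut p l q := by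
        rintro p l q hv hcut
        obtain ⟨p', q', hu', hp, hq⟩ := h2 p l q hv hcut
        obtain ⟨a, b, c⟩ := hcut
        exact hc p' l q' hu' ⟨by grind, by grind, by grind⟩
      intro M _ _ _ φ hφ
      have e1 := val_eq_sq_of_no_cut φ hφ _ [] u le_rfl hc (by simp)
      have e2 := val_eq_sq_of_no_cut φ hφ _ [] v le_rfl hc' (by simp)
      rw [List.nil_append] at e1 e2
      rw [e1, e2, val_sq_congr φ h]


/-! ### A normal form for words with a letter and its star -/

/-- No letter of the word occurs together with its star. -/
def NonMixed (w : List Letter) : Prop := ∀ l ∈ w, inv l ∉ w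

/-- No variable occurs in both words. -/
def VarDisjoint (u v : List Letter) : Prop := ∀ l ∈ u, l ∉ v ∧ inv l ∉ v

/-- The word `C C B C* C*`. -/
def frame (C B : List Letter) : List Letter := (C ++ C) ++ B ++ winv (C ++ C)

/-- The word `x x*`, whose value is a zero. -/
def zeroWord : List Letter := [(0, false), (0, true)]

/-- The frames to which words with a letter and its star are reduced. -/
structure Reduced (C B : List Letter) : Prop where
  ne_nil : C ≠ []
  left : NonMixed C
  right : NonMixed B
  disj : VarDisjoint C B
  first : ∃ l R, B = l :: R ∧ l ∉ R
  last : ∃ l R, B = R ++ [l] ∧ l ∉ R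

theorem NonMixed.winv {w : List Letter} (h : NonMixed w) : NonMixed (winv w) := by
  intro l hl hl'
  rw [mem_winv] at hl hl'
  exact h _ hl hl'

theorem VarDisjoint.winv {u v : List Letter} (h : VarDisjoint u v) :
    VarDisjoint u (winv v) := by
  intro l hl
  simpa [and_comm] using h l hl

theorem Reduced.winv {C B : List Letter} (h : Reduced C B) : Reduced C (winv B) := by
  obtain ⟨l, R, rfl, hl⟩ := h.first
  obtain ⟨m, S, hS, hm⟩ := h.last
  refine ⟨h.ne_nil, h.left, h.right.winv, h.disj.winv, ⟨inv m, InvSemi.winv S, ?_, ?_⟩,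
    ⟨inv l, InvSemi.winv R, ?_, ?_⟩⟩
  · rw [hS]; simp
  · simpa using hm
  · simp
  · simpa using hl

section Value

variable {M : Type} [Monoid M] [StarMul M] (φ : ℕ → M)

theorem val_frame (C B : List Letter) :
    val φ (frame C B) = val φ C ^ 2 * val φ B * star (val φ C ^ 2) := by
  simp [frame, pow_two, mul_assoc]

end Value

theorem weq_frame_winv {C : List Letter} (hC : C ≠ []) (B : List Letter) :
    WEq (frame C B) (frame C (winv B)) := by
  intro M _ _ _ φ hφ
  rw [val_frame, val_frame, val_winv, Model.star_conj _ _ (val_ne_one φ hφ hC)]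

theorem weq_frame_pull {C : List Letter} {t : Letter} (ht : t ∈ C) (X Y : List Letter) :
    WEq (frame C (X ++ t :: Y)) (frame (C ++ X) Y) := by
  intro M _ _ _ φ hφ
  have hC : C ≠ [] := List.ne_nil_of_mem ht
  rw [val_frame, val_frame, val_append, val_append, val_cons,
    ← Model.sq_conj _ _ _ (val_ne_one φ hφ hC)]
  have := Model.sq_mul_aba (val φ C) (val φ X) _ (letterVal_ne_one φ hφ t) (val_sq_mem φ ht)
  simp only [← mul_assoc]
  rw [this]

theorem weq_frame_aba {C : List Letter} (hC : C ≠ []) (t : Letter) (X Y : List Letter) :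
    WEq (frame C (t :: X ++ t :: Y)) (frame (C ++ t :: X) Y) := by
  intro M _ _ _ φ hφ
  rw [val_frame, val_frame, val_append, val_append,
    ← Model.sq_conj _ _ _ (val_ne_one φ hφ hC), val_cons, val_cons, Model.mul_sq,
    ← Model.aba_eq _ _ (letterVal_ne_one φ hφ t)]
  simp only [mul_assoc]

theorem weq_frame_of_pair (D T F : List Letter) (l : Letter) :
    WEq (D ++ l :: T ++ inv l :: F) (frame (winv F ++ D ++ [l]) T) := by
  intro M _ _ _ φ hφ
  have hl := letterVal_ne_one φ hφ l
  have h1 := Model.mul_conj (star (val φ F) * val φ D) _ (val φ T) hl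
  have h3 : ∀ d t : M, d * (letterVal φ l * t * star (letterVal φ l)) =
      letterVal φ l * t * star (letterVal φ l) * star d := by
    intro d t
    rw [Model.shift _ (star d) t hl, star_star]; simp only [mul_assoc]
  have hv : val φ (winv F ++ D ++ [l]) = star (val φ F) * val φ D * letterVal φ l := by
    simp [val_cons, mul_assoc]
  rw [val_frame, hv, ← h1]
  simp only [val_append, val_cons, letterVal_inv]
  generalize letterVal φ l = a at *
  calc val φ D * (a * val φ T) * (star a * val φ F)
      = val φ D * (a * val φ T * star a) * val φ F := by simp only [mul_assoc]
    _ = a * val φ T * star a * (star (val φ D) * val φ F) := by rw [h3]; simp only [mul_assoc]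
    _ = (star (val φ F) * val φ D) * (a * val φ T * star a) := by rw [h3]; simp
    _ = _ := by simp only [mul_assoc]

theorem weq_frame_nil {C : List Letter} (hC : C ≠ []) : WEq (frame C []) zeroWord := by
  intro M _ _ _ φ hφ
  have hc : val φ C ^ 2 ≠ 1 := by
    rw [pow_two]; exact Model.mul_ne_one _ _ (val_ne_one φ hφ hC)
  rw [val_frame, val_nil, mul_one, Model.mul_star_eq _ _ hc (hφ 0)]
  simp [zeroWord, val, letterVal]

theorem weq_frame_mixed {C : List Letter} (hC : ¬ NonMixed C) (B : List Letter) :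
    WEq (frame C B) zeroWord := by
  unfold NonMixed at hC
  push Not at hC
  obtain ⟨l, hl, hl'⟩ := hC
  intro M _ _ _ φ hφ
  have h1 := val_sq_mem φ hl
  have h2 := val_sq_mem φ hl'
  have hne : letterVal φ l ^ 2 ≠ 1 := by
    rw [pow_two]; exact Model.mul_ne_one _ _ (letterVal_ne_one φ hφ l)
  have h3 : val φ C ^ 2 = letterVal φ l ^ 2 * star (letterVal φ l ^ 2) := by
    rw [← Model.mul_mul_star _ (val φ C ^ 2) hne, ← mul_assoc, h1, star_pow, ← letterVal_inv, h2]
  rw [val_frame, h3, mul_assoc, Model.mul_star_mul _ _ hne, Model.mul_star_eq _ _ hne (hφ 0)]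
  simp [zeroWord, val, letterVal]

theorem exists_pair {w : List Letter} (h : ¬ NonMixed w) :
    ∃ D l T F, w = D ++ l :: T ++ inv l :: F := by
  unfold NonMixed at h
  push Not at h
  obtain ⟨l, hl, hl'⟩ := h
  obtain ⟨A, B, rfl⟩ := List.append_of_mem hl
  rcases List.mem_append.1 hl' with h | h
  · obtain ⟨X, Y, rfl⟩ := List.append_of_mem h
    exact ⟨X, inv l, Y, B, by simp⟩
  · rcases List.mem_cons.1 h with h | h
    · exact absurd h (inv_ne l)
    obtain ⟨X, Y, rfl⟩ := List.append_of_mem h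
    exact ⟨A, l, X, Y, by simp⟩

/-- A frame is a zero or equals a reduced frame.  As long as a frame is not reduced, its middle
part can be shortened by moving letters to `C`. -/
theorem frame_reduce (n : ℕ) : ∀ C B : List Letter, B.length ≤ n → C ≠ [] →
    WEq (frame C B) zeroWord ∨ ∃ C' B', Reduced C' B' ∧ WEq (frame C B) (frame C' B') := by
  induction n with
  | zero =>
    intro C B hB hC
    obtain rfl : B = [] := List.eq_nil_of_length_eq_zero (by omega)
    exact Or.inl (weq_frame_nil hC)
  | succ n ih =>
    intro C B hB hC
    have key : ∀ C' B', C' ≠ [] → B'.length ≤ n → WEq (frame C B) (frame C' B') →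
        WEq (frame C B) zeroWord ∨
          ∃ C' B', Reduced C' B' ∧ WEq (frame C B) (frame C' B') := by
      intro C' B' hC' hB' h
      rcases ih C' B' hB' hC' with h' | ⟨C'', B'', h1, h2⟩
      · exact Or.inl (h.trans h')
      · exact Or.inr ⟨C'', B'', h1, h.trans h2⟩
    by_cases hm : NonMixed C
    swap
    · exact Or.inl (weq_frame_mixed hm B)
    by_cases hmB : NonMixed B
    swap
    · obtain ⟨D, l, T, F, rfl⟩ := exists_pair hmB
      have := weq_frame_of_pair (C ++ C ++ D) T (F ++ winv (C ++ C)) l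
      simp only [List.length_append, List.length_cons] at hB
      refine key _ T (by simp) (by omega) (WEq.trans ?_ this)
      rw [show frame C (D ++ l :: T ++ inv l :: F) =
        C ++ C ++ D ++ l :: T ++ inv l :: (F ++ winv (C ++ C)) by simp [frame]]
      exact WEq.refl _
    by_cases hd : VarDisjoint C B
    swap
    · unfold VarDisjoint at hd
      push Not at hd
      obtain ⟨t, ht, hd⟩ := hd
      by_cases htB : t ∈ B
      · obtain ⟨X, Y, rfl⟩ := List.append_of_mem htB
        simp only [List.length_append, List.length_cons] at hB
        exact key _ Y (by simp [hC]) (by omega) (weq_frame_pull ht X Y)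
      · obtain ⟨X, Y, rfl⟩ := List.append_of_mem (hd htB)
        simp only [List.length_append, List.length_cons] at hB
        refine key (C ++ winv Y) (winv X) (by simp [hC]) (by simp; omega) ?_
        refine (weq_frame_winv hC _).trans ?_
        simpa using weq_frame_pull ht (winv Y) (winv X)
    rcases B.eq_nil_or_concat with rfl | ⟨S, m, hS⟩
    · exact Or.inl (weq_frame_nil hC)
    rw [List.concat_eq_append] at hS
    cases B with
    | nil => simp at hS
    | cons l R =>
      by_cases hl : l ∈ R
      · obtain ⟨X, Y, rfl⟩ := List.append_of_mem hl
        simp only [List.length_append, List.length_cons] at hB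
        exact key _ Y (by simp) (by omega) (weq_frame_aba hC l X Y)
      by_cases hmS : m ∈ S
      · obtain ⟨X, Y, rfl⟩ := List.append_of_mem hmS
        rw [hS] at hB
        simp only [List.length_append, List.length_cons] at hB
        refine key (C ++ inv m :: winv Y) (winv X) (by simp) (by simp; omega) ?_
        refine (weq_frame_winv hC _).trans ?_
        rw [hS]
        simpa using weq_frame_aba hC (inv m) (winv Y) (winv X)
      · exact Or.inr ⟨C, l :: R, ⟨hC, hm, hmB, hd, ⟨l, R, rfl, hl⟩, ⟨m, S, hS, hmS⟩⟩,
          WEq.refl _⟩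

theorem mixed_reduce {w : List Letter} (h : ¬ NonMixed w) :
    WEq w zeroWord ∨ ∃ C B, Reduced C B ∧ WEq w (frame C B) := by
  obtain ⟨D, l, T, F, rfl⟩ := exists_pair h
  have h1 := weq_frame_of_pair D T F l
  rcases frame_reduce _ _ T le_rfl (by simp : winv F ++ D ++ [l] ≠ []) with h2 | ⟨C, B, h2, h3⟩
  · exact Or.inl (h1.trans h2)
  · exact Or.inr ⟨C, B, h2, h1.trans h3⟩


/-! ### Adjoining a unit to a semigroup satisfying the identities -/

/-- The assignment of `a`, `b`, `c` to the variables `x`, `y`, `z`. -/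
def assign {S : Type} (a b c : S) : ℕ → S
  | 0 => a
  | 1 => b
  | _ => c

theorem exists_coe_of_ne_one {S : Type} {a : WithOne S} (h : a ≠ 1) : ∃ b : S, a = b := by
  induction a with
  | one => exact absurd rfl h
  | coe b => exact ⟨b, rfl⟩

section WithOne

variable {S : Type} [Semigroup S] [StarMul S]

instance : StarMul (WithOne S) where
  star := WithOne.recOneCoe 1 fun a => ((star a : S) : WithOne S)
  star_involutive := by
    intro a
    induction a with
    | one => rfl
    | coe a => exact congrArg _ (star_star a)
  star_mul := by
    intro a b
    induction a with
    | one =>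
      rw [one_mul]; exact (mul_one _).symm
    | coe a =>
      induction b with
      | one => rw [mul_one]; exact (one_mul _).symm
      | coe b => exact congrArg _ (star_mul a b)

theorem coe_star (a : S) : star (a : WithOne S) = ((star a : S) : WithOne S) := rfl

/-- If `S` satisfies the identities of `basisB0`, then they also hold with a unit adjoined, as
far as only the variable `T` or variables on which the identity is trivial become the unit. -/
theorem model_withOne (h : ∀ i ∈ basisB0, Satisfies S i) : Model (WithOne S) := by
  have h1 : ∀ a b : S, a * star a * a * b = a * star a * a := fun a b =>
    h ⟨x * star x * x * y, x * star x * x⟩ (.inl (.inr (.inl rfl))) (assign a b a)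
  have h2 : ∀ a b : S, a * star a * a = b * a * star a * a := fun a b =>
    h ⟨x * star x * x, y * x * star x * x⟩ (.inl (.inr (.inr (.inl rfl)))) (assign a b a)
  have h3 : ∀ a b : S, a * b * star a = a * star b * star a := fun a b =>
    h ⟨x * y * star x, x * star y * star x⟩ (.inl (.inr (.inr (.inr (.inl rfl))))) (assign a b a)
  have h4 : ∀ a b c : S, a * c * star a * b = star b * a * c * star a := fun a b c =>
    h ⟨x * z * star x * y, star y * x * z * star x⟩ (.inl (.inr (.inr (.inr (.inr (.inl rfl)))))) (assign a b c)
  have h5 : ∀ a b : S, a * star a * b = star b * a * star a := fun a b =>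
    h ⟨x * star x * y, star y * x * star x⟩ (.inl (.inr (.inr (.inr (.inr (.inr (.inl rfl))))))) (assign a b a)
  have h6 : ∀ a c : S, a * a * c * star a = a * c * star a := fun a c =>
    h ⟨x * x * z * star x, x * z * star x⟩ (.inl (.inr (.inr (.inr (.inr (.inr (.inr (.inl rfl)))))))) (assign a a c)
  have h7 : ∀ a : S, a * a * star a = a * star a := fun a =>
    h ⟨x * x * star x, x * star x⟩ (.inl (.inr (.inr (.inr (.inr (.inr (.inr (.inr (.inl rfl))))))))) (assign a a a)
  have h8 : ∀ a c : S, a * c * star a = a * c * star a * star a := fun a c =>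
    h ⟨x * z * star x, x * z * star x * star x⟩ (.inl (.inr (.inr (.inr (.inr (.inr (.inr (.inr (.inr (.inl rfl)))))))))) (assign a a c)
  have h9 : ∀ a : S, a * star a = a * star a * star a := fun a =>
    h ⟨x * star x, x * star x * star x⟩ (.inl (.inr (.inr (.inr (.inr (.inr (.inr (.inr (.inr (.inr (.inl rfl))))))))))) (assign a a a)
  have h10 : ∀ a : S, a * a = a * a * a := fun a =>
    h ⟨x * x, x * x * x⟩ (.inl (.inr (.inr (.inr (.inr (.inr (.inr (.inr (.inr (.inr (.inr (.inl rfl)))))))))))) (assign a a a)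
  have h11 : ∀ a b : S, a * b * a = b * a * b := fun a b =>
    h ⟨x * y * x, y * x * y⟩ (.inl (.inr (.inr (.inr (.inr (.inr (.inr (.inr (.inr (.inr (.inr (.inr (.inl rfl))))))))))))) (assign a b a)
  have h12 : ∀ a b : S, b * a * b = a * b * a * b := fun a b =>
    h ⟨y * x * y, x * y * x * y⟩ (.inl (.inr (.inr (.inr (.inr (.inr (.inr (.inr (.inr (.inr (.inr (.inr (.inr rfl))))))))))))) (assign a b a)
  have h13 : ∀ a b : S, a * a * b * b = b * b * a * a := fun a b =>
    h ⟨x * x * y * y, y * y * x * x⟩ (.inr rfl) (assign a b a)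
  refine ⟨?_, ?_, ?_, ?_, ?_, ?_, ?_, ?_, ?_, ?_, ?_⟩
  · intro a b ha
    obtain ⟨a, rfl⟩ := exists_coe_of_ne_one ha
    induction b with
    | one => simp
    | coe b => rw [← WithOne.coe_mul]; exact WithOne.coe_ne_one
  · intro a b ha
    obtain ⟨a, rfl⟩ := exists_coe_of_ne_one ha
    induction b with
    | one => simp
    | coe b => exact congrArg _ (h1 a b)
  · intro a b ha
    obtain ⟨a, rfl⟩ := exists_coe_of_ne_one ha
    induction b with
    | one => simp
    | coe b => exact congrArg _ (h2 a b)
  · intro a b ha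
    obtain ⟨a, rfl⟩ := exists_coe_of_ne_one ha
    induction b with
    | one => simp
    | coe b => exact congrArg _ (h3 a b)
  · intro a b t ha
    obtain ⟨a, rfl⟩ := exists_coe_of_ne_one ha
    induction b with
    | one => simp
    | coe b =>
      induction t with
      | one => rw [mul_one, mul_one]; exact congrArg _ (h5 a b)
      | coe t => exact congrArg _ (h4 a b t)
  · intro a t
    induction a with
    | one => simp
    | coe a =>
      induction t with
      | one => rw [mul_one, mul_one]; exact congrArg _ (h7 a)
      | coe t => exact congrArg _ (h6 a t)
  · intro a t
    induction a with
    | one => simp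
    | coe a =>
      induction t with
      | one => rw [mul_one]; exact congrArg _ (h9 a)
      | coe t => exact congrArg _ (h8 a t)
  · intro a
    induction a with
    | one => simp
    | coe a => exact congrArg _ (h10 a)
  · intro a b ha hb
    obtain ⟨a, rfl⟩ := exists_coe_of_ne_one ha
    obtain ⟨b, rfl⟩ := exists_coe_of_ne_one hb
    exact congrArg _ (h11 a b)
  · intro a b ha hb
    obtain ⟨a, rfl⟩ := exists_coe_of_ne_one ha
    obtain ⟨b, rfl⟩ := exists_coe_of_ne_one hb
    exact congrArg _ (h12 a b)
  · intro a b
    induction a with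
    | one => simp
    | coe a =>
      induction b with
      | one => simp
      | coe b => exact congrArg _ (h13 a b)

end WithOne

/-! ### Terms, words, and the free algebra modulo the identities -/

/-- The word obtained from a term by moving all stars to the variables. -/
def Term.word : Term → List Letter
  | .var n => [(n, false)]
  | .mul s t => s.word ++ t.word
  | .star s => winv s.word

theorem val_word {S : Type} [Semigroup S] [StarMul S] (φ : ℕ → S) (t : Term) :
    val (fun n => (φ n : WithOne S)) t.word = (t.eval φ : S) := by
  induction t with
  | var n => simp [Term.word, val, letterVal, Term.eval]
  | mul s t hs ht => simp [Term.word, Term.eval, hs, ht]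
  | star s hs => rw [Term.word, val_winv, hs]; rfl

theorem Term.word_ne_nil (t : Term) : t.word ≠ [] := by
  induction t with
  | var n => simp [Term.word]
  | mul s t hs ht => simp [Term.word, hs]
  | star s hs =>
    intro h
    apply hs
    rw [← winv_winv s.word, show winv s.word = [] from h, winv_nil]

/-- Deducibility of `s ≈ t` from `basisB0`, as an equivalence relation on terms. -/
def dedSetoid : Setoid Term := Relation.EqvGen.setoid (Rewrites (insert assocLaw basisB0))

/-- The terms modulo the identities of `basisB0`. -/
def FreeAlg : Type := Quotient dedSetoid

namespace FreeAlg

/-- The class of a term. -/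
def mk (t : Term) : FreeAlg := Quotient.mk dedSetoid t

theorem eqvGen_lift {f : Term → Term} {s t : Term}
    (hf : ∀ s t, Rewrites (insert assocLaw basisB0) s t →
      Rewrites (insert assocLaw basisB0) (f s) (f t))
    (h : Relation.EqvGen (Rewrites (insert assocLaw basisB0)) s t) :
    Relation.EqvGen (Rewrites (insert assocLaw basisB0)) (f s) (f t) := by
  induction h with
  | rel s t h => exact .rel _ _ (hf _ _ h)
  | refl s => exact .refl _
  | symm s t _ ih => exact .symm _ _ ih
  | trans s t u _ _ ih ih' => exact .trans _ _ _ ih ih'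

instance : Mul FreeAlg :=
  ⟨Quotient.map₂ (fun s t : Term => Term.mul s t) fun _ _ h _ _ k =>
    .trans _ _ _ (eqvGen_lift (f := fun s => s.mul _) (fun _ _ => .mulLeft _) h)
      (eqvGen_lift (f := fun s => Term.mul _ s) (fun _ _ => .mulRight _) k)⟩

instance : Star FreeAlg :=
  ⟨Quotient.map (fun s : Term => Term.star s) fun _ _ h => eqvGen_lift (f := Term.star) (fun _ _ => .star) h⟩

theorem eval_mk (φ : ℕ → Term) (t : Term) :
    t.eval (fun n => mk (φ n)) = mk (t.subst φ) := by
  induction t with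
  | var n => rfl
  | mul s t hs ht => rw [Term.eval, hs, ht]; rfl
  | star s hs => rw [Term.eval, hs]; rfl

theorem eval_mk_var (t : Term) : t.eval (fun n => mk (.var n)) = mk t := by
  induction t with
  | var n => rfl
  | mul s t hs ht => rw [Term.eval, hs, ht]; rfl
  | star s hs => rw [Term.eval, hs]; rfl

theorem satisfies (i : Identity) (hi : i ∈ insert assocLaw basisB0) : Satisfies FreeAlg i := by
  intro φ
  have : φ = fun n => mk (φ n).out := by
    funext n; exact (Quotient.out_eq (φ n)).symm
  rw [this, eval_mk, eval_mk]
  exact Quotient.sound (s := dedSetoid) (.rel _ _ (.inst hi _))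

instance : Semigroup FreeAlg where
  mul_assoc a b c := satisfies assocLaw (.inl rfl) (assign a b c)

instance : StarMul FreeAlg where
  star_involutive a := satisfies ⟨star (star x), x⟩ (.inr (.inl (.inl (.inl rfl))))
    (assign a a a)
  star_mul a b := satisfies ⟨star (x * y), star y * star x⟩
    (.inr (.inl (.inl (.inr rfl)))) (assign a b a)

instance : Model (WithOne FreeAlg) := model_withOne fun i hi => satisfies i (Or.inr hi)

end FreeAlg

theorem deducible_of_weq {s t : Term} (h : WEq s.word t.word) : Deducible basisB0 ⟨s, t⟩ := by
  have h1 := h (WithOne FreeAlg) (fun n => (FreeAlg.mk (.var n) : WithOne FreeAlg))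
    fun _ => WithOne.coe_ne_one
  rw [val_word, val_word, FreeAlg.eval_mk_var, FreeAlg.eval_mk_var] at h1
  exact Quotient.exact (s := dedSetoid) (WithOne.coe_injective h1)

/-! ### The values of words in `B0` -/

theorem B0.satisfies_basis : ∀ i ∈ basisB0, Satisfies B0 i := by
  intro i hi φ
  simp only [basisB0, involutionIdentities, mixedIdentities, Set.mem_union, Set.mem_insert_iff,
    Set.mem_singleton_iff] at hi
  rcases hi with ((rfl | rfl) | hi) | rfl
  · change star (star (φ 0)) = φ 0
    generalize φ 0 = a; cases a <;> rfl
  · change star (φ 0 * φ 1) = star (φ 1) * star (φ 0)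
    generalize φ 0 = a; generalize φ 1 = b; cases a <;> cases b <;> rfl
  · rcases hi with rfl | rfl | rfl | rfl | rfl | rfl | rfl | rfl | rfl | rfl | rfl | rfl <;>
      simp only [x, y, z] <;>
      simp only [HMul.hMul, Mul.mul, Star.star, Term.eval] <;>
      generalize φ 0 = a <;> generalize φ 1 = b <;> generalize φ 2 = c <;>
      cases a <;> first | rfl | (cases b <;> first | rfl | (cases c <;> rfl))
  · change φ 0 * φ 0 * φ 1 * φ 1 = φ 1 * φ 1 * φ 0 * φ 0
    generalize φ 0 = a; generalize φ 1 = b; cases a <;> cases b <;> rfl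

instance : Model (WithOne B0) := model_withOne B0.satisfies_basis


/-- The value of a word in `B0`, with a unit adjoined for the empty word. -/
def bval (φ : ℕ → B0) (w : List Letter) : WithOne B0 := val (fun n => (φ n : WithOne B0)) w

/-- The identity `u ≈ v` holds in `B0`. -/
def HoldsB0 (u v : List Letter) : Prop := ∀ φ : ℕ → B0, bval φ u = bval φ v

theorem HoldsB0.symm {u v : List Letter} (h : HoldsB0 u v) : HoldsB0 v u := fun φ => (h φ).symm

theorem HoldsB0.trans {u v w : List Letter} (h : HoldsB0 u v) (k : HoldsB0 v w) :
    HoldsB0 u w := fun φ => (h φ).trans (k φ)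

theorem WEq.holdsB0 {u v : List Letter} (h : WEq u v) : HoldsB0 u v :=
  fun φ => h (WithOne B0) _ fun n => WithOne.coe_ne_one (a := φ n)

/-- The value of a letter in `B0`. -/
def lval (φ : ℕ → B0) (l : Letter) : B0 := if l.2 then star (φ l.1) else φ l.1

theorem bval_cons (φ : ℕ → B0) (l : Letter) (w : List Letter) :
    bval φ (l :: w) = (lval φ l : WithOne B0) * bval φ w := by
  rw [bval, val_cons]
  congr 1
  rcases l with ⟨n, _ | _⟩ <;> simp [letterVal, lval, coe_star]

theorem bval_eq_one {φ : ℕ → B0} {w : List Letter} : bval φ w = 1 ↔ w = [] := by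
  cases w with
  | nil => simp [bval]
  | cons l w =>
    simp only [reduceCtorEq, iff_false]
    exact val_ne_one _ (fun n => WithOne.coe_ne_one) (by simp)

namespace B0

theorem coe_mul_eq_e4 (a : B0) (b : WithOne B0) :
    ((a : WithOne B0) * b = 1 ∨ (a : WithOne B0) * b = (e4 : B0)) ↔
      a = e4 ∧ (b = 1 ∨ b = (e4 : B0)) := by
  induction b with
  | one => simp
  | coe b =>
    rw [← WithOne.coe_mul]
    simp only [WithOne.coe_ne_one, WithOne.coe_inj, false_or]
    revert a b
    rintro (_ | _ | _ | _) (_ | _ | _ | _) <;> simp [HMul.hMul, Mul.mul, B0.mul]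

theorem coe_mul_eq_e3 (a : B0) (b : WithOne B0) :
    ((a : WithOne B0) * b = 1 ∨ (a : WithOne B0) * b = (e3 : B0)) ↔
      a = e3 ∧ (b = 1 ∨ b = (e3 : B0)) := by
  induction b with
  | one => simp
  | coe b =>
    rw [← WithOne.coe_mul]
    simp only [WithOne.coe_ne_one, WithOne.coe_inj, false_or]
    revert a b
    rintro (_ | _ | _ | _) (_ | _ | _ | _) <;> simp [HMul.hMul, Mul.mul, B0.mul]

theorem coe_mul_eq_e1 (a : B0) (b : WithOne B0) :
    (a : WithOne B0) * b = (e1 : B0) ↔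
      (a = e4 ∧ b = (e1 : B0)) ∨ (a = e1 ∧ (b = 1 ∨ b = (e3 : B0))) := by
  induction b with
  | one => simp [WithOne.one_ne_coe]
  | coe b =>
    rw [← WithOne.coe_mul]
    simp only [WithOne.coe_ne_one, WithOne.coe_inj, false_or]
    revert a b
    rintro (_ | _ | _ | _) (_ | _ | _ | _) <;> simp [HMul.hMul, Mul.mul, B0.mul]

end B0

theorem bval_eq_e4 {φ : ℕ → B0} {w : List Letter} :
    (bval φ w = 1 ∨ bval φ w = (B0.e4 : B0)) ↔ ∀ l ∈ w, lval φ l = B0.e4 := by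
  induction w with
  | nil => simp [bval]
  | cons l w ih => rw [bval_cons, B0.coe_mul_eq_e4, ih, List.forall_mem_cons]

theorem bval_eq_e3 {φ : ℕ → B0} {w : List Letter} :
    (bval φ w = 1 ∨ bval φ w = (B0.e3 : B0)) ↔ ∀ l ∈ w, lval φ l = B0.e3 := by
  induction w with
  | nil => simp [bval]
  | cons l w ih => rw [bval_cons, B0.coe_mul_eq_e3, ih, List.forall_mem_cons]

theorem bval_eq_e1 {φ : ℕ → B0} {w : List Letter} :
    bval φ w = (B0.e1 : B0) ↔ ∃ p l q, w = p ++ l :: q ∧ lval φ l = B0.e1 ∧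
      (∀ m ∈ p, lval φ m = B0.e4) ∧ ∀ m ∈ q, lval φ m = B0.e3 := by
  induction w with
  | nil => simp [bval, WithOne.one_ne_coe]
  | cons k w ih =>
    rw [bval_cons, B0.coe_mul_eq_e1, ih, bval_eq_e3]
    constructor
    · rintro (⟨hk, p, l, q, rfl, h1, h2, h3⟩ | ⟨hk, h⟩)
      · exact ⟨k :: p, l, q, rfl, h1, List.forall_mem_cons.2 ⟨hk, h2⟩, h3⟩
      · exact ⟨[], k, w, rfl, hk, by simp, h⟩
    · rintro ⟨_ | ⟨k', p⟩, l, q, he, h1, h2, h3⟩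
      · obtain ⟨rfl, rfl⟩ := List.cons.inj he
        exact Or.inr ⟨h1, h3⟩
      · obtain ⟨rfl, rfl⟩ := List.cons.inj he
        rw [List.forall_mem_cons] at h2
        exact Or.inl ⟨h2.1, p, l, q, rfl, h1, h2.2, h3⟩

open Classical in
/-- The assignment in `B0` that gives the variables in `A` the value `1` and all other letters
in `C` the value `4`. -/
noncomputable def asg (A : Set ℕ) (C : Set Letter) (n : ℕ) : B0 :=
  if n ∈ A then B0.e1 else if (n, false) ∈ C then B0.e4 else if (n, true) ∈ C then B0.e3
  else B0.e2

section Asg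

variable {A : Set ℕ} {C : Set Letter} (hC : ∀ l ∈ C, inv l ∉ C)

theorem lval_inv (φ : ℕ → B0) (l : Letter) : lval φ (inv l) = star (lval φ l) := by
  rcases l with ⟨n, _ | _⟩ <;> simp [lval, inv]

theorem lval_asg_e1 {l : Letter} : lval (asg A C) l = B0.e1 ↔ l.1 ∈ A := by
  rcases l with ⟨n, _ | _⟩ <;> simp only [lval, asg] <;> split_ifs <;> simp_all [star, B0.star]

include hC in
theorem lval_asg_e4 {l : Letter} : lval (asg A C) l = B0.e4 ↔ l.1 ∉ A ∧ l ∈ C := by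
  rcases l with ⟨n, _ | _⟩
  · by_cases h1 : n ∈ A <;> by_cases h2 : (n, false) ∈ C <;> by_cases h3 : (n, true) ∈ C <;>
      simp [lval, asg, h1, h2, h3]
  · by_cases h3 : (n, true) ∈ C
    · have h2 : (n, false) ∉ C := hC _ h3
      by_cases h1 : n ∈ A <;> simp [lval, asg, h1, h2, h3, star, B0.star]
    · by_cases h1 : n ∈ A <;> by_cases h2 : (n, false) ∈ C <;>
      simp [lval, asg, h1, h2, h3, star, B0.star]

include hC in
theorem lval_asg_e3 {l : Letter} : lval (asg A C) l = B0.e3 ↔ l.1 ∉ A ∧ inv l ∈ C := by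
  rw [← inv_fst l, ← lval_asg_e4 hC, lval_inv]
  cases lval (asg A C) l <;> simp [star, B0.star]

end Asg

/-- In the word `w` the variable `n` occurs exactly once; `K` consists of the letters before this
occurrence and the stars of those after it, and does not contain a letter with its star. -/
def Pair (w : List Letter) (n : ℕ) (K : Set Letter) : Prop :=
  ∃ p l q, w = p ++ l :: q ∧ l.1 = n ∧ (∀ m ∈ p, m.1 ≠ n) ∧ (∀ m ∈ q, m.1 ≠ n) ∧
    (∀ m, m ∈ K ↔ m ∈ p ∨ inv m ∈ q) ∧ ∀ m ∈ K, inv m ∉ K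

theorem unique_split {n : ℕ} {p q p' q' : List Letter} {l l' : Letter}
    (h : p ++ l :: q = p' ++ l' :: q') (hl' : l'.1 = n)
    (hp : ∀ m ∈ p, m.1 ≠ n) (hq : ∀ m ∈ q, m.1 ≠ n) :
    p = p' ∧ l = l' ∧ q = q' := by
  induction p generalizing p' with
  | nil =>
    cases p' with
    | nil => simpa using h
    | cons k p' =>
      simp only [List.nil_append, List.cons_append, List.cons.injEq] at h
      exact absurd hl' (hq l' (by simp [h.2]))
  | cons a p ih =>
    cases p' with
    | nil =>
      simp only [List.nil_append, List.cons_append, List.cons.injEq] at h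
      exact absurd hl' (by rw [← h.1]; exact hp a (by simp))
    | cons k p' =>
      simp only [List.cons_append, List.cons.injEq] at h
      obtain ⟨rfl, h⟩ := h
      obtain ⟨h1, h2⟩ := ih h fun m hm => hp m (by simp [hm])
      exact ⟨by rw [h1], h2⟩

theorem exists_split_of_holdsB0 {u v : List Letter} {n : ℕ} {K : Set Letter}
    (h : HoldsB0 u v) (hu : Pair u n K) :
    ∃ p l q, v = p ++ l :: q ∧ l.1 = n ∧ (∀ m ∈ p, m.1 ≠ n ∧ m ∈ K) ∧
      ∀ m ∈ q, m.1 ≠ n ∧ inv m ∈ K := by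
  obtain ⟨p, l, q, rfl, hl, hp, hq, hK, hN⟩ := hu
  have h1 : bval (asg {n} K) (p ++ l :: q) = (B0.e1 : B0) := by
    refine bval_eq_e1.2 ⟨p, l, q, rfl, lval_asg_e1.2 hl, fun m hm => ?_, fun m hm => ?_⟩
    · exact (lval_asg_e4 hN).2 ⟨hp m hm, (hK m).2 (Or.inl hm)⟩
    · exact (lval_asg_e3 hN).2 ⟨hq m hm, (hK _).2 (Or.inr (by simpa using hm))⟩
  rw [h] at h1
  obtain ⟨p', l', q', h2, h3, h4, h5⟩ := bval_eq_e1.1 h1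
  exact ⟨p', l', q', h2, lval_asg_e1.1 h3, fun m hm => (lval_asg_e4 hN).1 (h4 m hm),
    fun m hm => (lval_asg_e3 hN).1 (h5 m hm)⟩

/-- The pairs of a word are determined by its values in `B0`. -/
theorem Pair.of_holdsB0 {u v : List Letter} {n : ℕ} {K : Set Letter}
    (h : HoldsB0 u v) (hu : Pair u n K) : Pair v n K := by
  obtain ⟨p', l', q', rfl, hl', hp', hq'⟩ := exists_split_of_holdsB0 h hu
  obtain ⟨p, l, q, rfl, hl, hp, hq, hK, hN⟩ := hu
  have sub : ∀ m, m ∈ p' ∨ inv m ∈ q' → m ∈ K := by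
    rintro m (hm | hm)
    · exact (hp' m hm).2
    · simpa using (hq' _ hm).2
  have hv : Pair (p' ++ l' :: q') n {m | m ∈ p' ∨ inv m ∈ q'} :=
    ⟨p', l', q', rfl, hl', fun m hm => (hp' m hm).1, fun m hm => (hq' m hm).1, fun m => Iff.rfl,
      fun m hm hm' => hN m (sub _ hm) (sub _ hm')⟩
  obtain ⟨p'', l'', q'', he, hl'', hp'', hq''⟩ := exists_split_of_holdsB0 h.symm hv
  obtain ⟨rfl, rfl, rfl⟩ := unique_split he hl'' hp hq
  refine ⟨p', l', q', rfl, hl', fun m hm => (hp' m hm).1, fun m hm => (hq' m hm).1,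
    fun m => ⟨fun hm => ?_, sub m⟩, hN⟩
  rcases (hK m).1 hm with hm | hm
  · exact (hp'' m hm).2
  · simpa using (hq'' _ hm).2

theorem mem_of_holdsB0 {u v : List Letter} (hu : NonMixed u) (hne : u ≠ [])
    (h : HoldsB0 u v) : ∀ l ∈ v, l ∈ u := by
  have h1 : bval (asg ∅ {l | l ∈ u}) u = (B0.e4 : B0) := by
    refine (bval_eq_e4.2 fun l hl => (lval_asg_e4 ?_).2 ⟨by simp, hl⟩).resolve_left
      (by rwa [bval_eq_one])
    exact hu
  rw [h] at h1
  exact fun l hl => ((lval_asg_e4 hu).1 (bval_eq_e4.1 (Or.inr h1) l hl)).2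

/-! ### Comparison of words with the same values in `B0` -/

theorem cutsLe_of_pairs {K : List Letter} {u v : List Letter} (hu : NonMixed u)
    (huv : ∀ l, l ∈ u ↔ l ∈ v) (hK : VarDisjoint K u)
    (h : ∀ p l q, u = p ++ l :: q → IsCut p l q → ∃ p' l' q', v = p' ++ l' :: q' ∧ l'.1 = l.1 ∧
      ∀ m, (m ∈ K ∨ m ∈ p ∨ inv m ∈ q) ↔ (m ∈ K ∨ m ∈ p' ∨ inv m ∈ q')) :
    CutsLe u v := by
  intro p l q he hc
  obtain ⟨p', l', q', he', hl, hm⟩ := h p l q he hc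
  have hv : ∀ m, m ∈ v ↔ m ∈ p' ∨ m = l' ∨ m ∈ q' := by intro m; simp [he']
  have hu' : ∀ m, m ∈ u ↔ m ∈ p ∨ m = l ∨ m ∈ q := by intro m; simp [he]
  obtain rfl : l' = l := by
    rcases eq_or_eq_inv hl with h | h
    · exact h
    · have h1 := hu l (by simp [he])
      have h2 := (huv l').2 (by simp [he'])
      rw [h] at h2
      exact absurd h2 h1
  have aux : ∀ p q p' q' : List Letter, (∀ m ∈ p, m ∈ u) → (∀ m ∈ q, m ∈ u) →
      (∀ m ∈ p', m ∈ u) → (∀ m ∈ q', m ∈ u) →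
      (∀ m, (m ∈ K ∨ m ∈ p ∨ inv m ∈ q) → (m ∈ K ∨ m ∈ p' ∨ inv m ∈ q')) →
      (∀ m ∈ p, m ∈ p') ∧ ∀ m ∈ q, m ∈ q' := by
    intro p q p' q' hp hq hp' hq' hm
    refine ⟨fun m h => ?_, fun m h => ?_⟩
    · rcases hm m (Or.inr (Or.inl h)) with h1 | h1 | h1
      · exact absurd (hp m h) (hK m h1).1
      · exact h1
      · exact absurd (hq' _ h1) (hu m (hp m h))
    · rcases hm (inv m) (Or.inr (Or.inr (by simpa using h))) with h1 | h1 | h1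
      · exact absurd (hq m h) (by simpa using (hK _ h1).2)
      · exact absurd (hp' _ h1) (hu m (hq m h))
      · simpa using h1
  have a1 : ∀ m ∈ p, m ∈ u := fun m h => (hu' m).2 (Or.inl h)
  have a2 : ∀ m ∈ q, m ∈ u := fun m h => (hu' m).2 (Or.inr (Or.inr h))
  have a3 : ∀ m ∈ p', m ∈ u := fun m h => (huv m).2 ((hv m).2 (Or.inl h))
  have a4 : ∀ m ∈ q', m ∈ u := fun m h => (huv m).2 ((hv m).2 (Or.inr (Or.inr h)))
  have h1 := aux p q p' q' a1 a2 a3 a4 fun m => (hm m).1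
  have h2 := aux p' q' p q a3 a4 a1 a2 fun m => (hm m).2
  exact ⟨p', q', he', fun m => ⟨h1.1 m, h2.1 m⟩, fun m => ⟨h1.2 m, h2.2 m⟩⟩

theorem pair_of_cut {u p q : List Letter} {l : Letter} (hu : NonMixed u) (he : u = p ++ l :: q)
    (hc : IsCut p l q) : Pair u l.1 {m | m ∈ p ∨ inv m ∈ q} := by
  have hu' : ∀ m, m ∈ u ↔ m ∈ p ∨ m = l ∨ m ∈ q := by intro m; simp [he]
  obtain ⟨h1, h2, h3⟩ := hc
  have hl := hu l (by simp [he])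
  refine ⟨p, l, q, he, rfl, fun m hm h => ?_, fun m hm h => ?_, fun m => Iff.rfl, ?_⟩
  · rcases eq_or_eq_inv h with rfl | rfl
    · exact h1 hm
    · exact hl ((hu' _).2 (Or.inl hm))
  · rcases eq_or_eq_inv h with rfl | rfl
    · exact h2 hm
    · exact hl ((hu' _).2 (Or.inr (Or.inr hm)))
  · intro m hm hm'
    simp only [Set.mem_ofPred_eq, inv_inv] at hm hm'
    have := hu m
    have := h3 m
    have := h3 (inv m)
    have := hu' m
    have := hu' (inv m)
    tauto

theorem weq_of_nonMixed {u v : List Letter} (hu : NonMixed u) (hune : u ≠ []) (hvne : v ≠ [])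
    (h : HoldsB0 u v) : WEq u v := by
  have h1 := mem_of_holdsB0 hu hune h
  have hv : NonMixed v := fun l hl hl' => hu l (h1 l hl) (h1 _ hl')
  have h2 := mem_of_holdsB0 hv hvne h.symm
  have key : ∀ u v : List Letter, NonMixed u → (∀ l, l ∈ u ↔ l ∈ v) → HoldsB0 u v →
      CutsLe u v := by
    intro u v hu huv h
    refine cutsLe_of_pairs (K := []) hu huv (by intro l hl; simp at hl) fun p l q he hc => ?_
    have h1 := pair_of_cut hu he hc
    obtain ⟨p', l', q', h3, h4, -, -, h5, -⟩ := h1.of_holdsB0 h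
    exact ⟨p', l', q', h3, h4, fun m => by simpa using h5 m⟩
  exact weq_of_cutsLe _ u v le_rfl (fun l => ⟨h2 l, h1 l⟩)
    (key u v hu (fun l => ⟨h2 l, h1 l⟩) h) (key v u hv (fun l => ⟨h1 l, h2 l⟩) h.symm)


theorem Reduced.pair_frame {C B p q : List Letter} {l : Letter} (h : Reduced C B)
    (he : B = p ++ l :: q) (hc : IsCut p l q) :
    Pair (frame C B) l.1 {m | m ∈ C ∨ m ∈ p ∨ inv m ∈ q} := by
  obtain ⟨p', l', q', he', hl', hp, hq, -, hN⟩ := pair_of_cut h.right he hc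
  obtain ⟨rfl, rfl, rfl⟩ := unique_split (he.symm.trans he') hl' (fun m hm h' => by
      have := h.right l (by simp [he])
      rcases eq_or_eq_inv h' with rfl | rfl
      · exact hc.1 hm
      · exact this (by simp [he, hm])) (fun m hm h' => by
      have := h.right l (by simp [he])
      rcases eq_or_eq_inv h' with rfl | rfl
      · exact hc.2.1 hm
      · exact this (by simp [he, hm]))
  have hCl : ∀ m ∈ C, m.1 ≠ l.1 := by
    intro m hm h'
    have := h.disj m hm
    rcases eq_or_eq_inv h' with rfl | rfl
    · exact this.1 (by simp [he])
    · exact this.2 (by simp [he])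
  have hB : ∀ m, m ∈ p ∨ inv m ∈ q → m ∈ B ∨ inv m ∈ B := by
    rintro m (hm | hm)
    · exact Or.inl (by simp [he, hm])
    · exact Or.inr (by simp [he, hm])
  refine ⟨C ++ C ++ p, l, q ++ InvSemi.winv (C ++ C), by simp [frame, he], rfl, ?_, ?_, ?_, ?_⟩
  · intro m hm
    simp only [List.mem_append] at hm
    rcases hm with (hm | hm) | hm
    exacts [hCl m hm, hCl m hm, hp m hm]
  · intro m hm
    simp only [List.mem_append, mem_winv] at hm
    rcases hm with hm | hm | hm
    exacts [hq m hm, hCl (inv m) hm, hCl (inv m) hm]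
  · intro m
    simp only [Set.mem_ofPred_eq, List.mem_append, mem_winv, inv_inv]
    tauto
  · rintro m (hm | hm) (hm' | hm')
    · exact h.left m hm hm'
    · have h1 := hB _ hm'
      have h2 := h.disj m hm
      rw [inv_inv] at h1
      tauto
    · have h1 := hB _ hm
      have h2 := h.disj _ hm'
      rw [inv_inv] at h2
      tauto
    · exact hN m hm hm'

theorem exists_split_of_pair_frame {C B : List Letter} {n : ℕ} {K : Set Letter}
    (h : Pair (frame C B) n K) : ∃ p l q, B = p ++ l :: q ∧ l.1 = n ∧
      ∀ m, m ∈ K ↔ m ∈ C ∨ m ∈ p ∨ inv m ∈ q := by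
  obtain ⟨P, l, Q, he, hl, hP, hQ, hK, -⟩ := h
  -- the variable `n` occurs only once in the frame, hence not in `C`
  have hcount : (frame C B).countP (fun m => m.1 = n) = 1 := by
    rw [he, List.countP_append, List.countP_cons, List.countP_eq_zero.2, List.countP_eq_zero.2]
    · simp [hl]
    · simpa using fun a b hm => hQ (a, b) hm
    · simpa using fun a b hm => hP (a, b) hm
  simp only [frame, winv_append, List.countP_append] at hcount
  have h0 : (C.countP fun m => m.1 = n) = 0 := by omega
  have h1 : ((winv C).countP fun m => m.1 = n) = 0 := by omega
  have h2 : (B.countP fun m => m.1 = n) = 1 := by omega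
  obtain ⟨l', hl', hn⟩ := List.countP_pos_iff.1 (by omega : 0 < B.countP fun m => m.1 = n)
  obtain ⟨p, q, rfl⟩ := List.append_of_mem hl'
  have hn' : l'.1 = n := by simpa using hn
  obtain ⟨rfl, rfl, rfl⟩ := unique_split (n := n) (p' := C ++ C ++ p) (l' := l')
    (q' := q ++ winv (C ++ C)) (he.symm.trans (by simp [frame])) hn' hP hQ
  refine ⟨p, l, q, rfl, hl, fun m => ?_⟩
  rw [hK]
  simp only [List.mem_append, mem_winv, inv_inv]
  tauto

/-- Cuts of the middle part of a reduced frame can be found in every frame with the same values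
in `B0`. -/
theorem Reduced.transfer {C B C' B' : List Letter} (h : Reduced C B)
    (hB : HoldsB0 (frame C B) (frame C' B')) (p : List Letter) (l : Letter) (q : List Letter)
    (he : B = p ++ l :: q) (hc : IsCut p l q) :
    ∃ p' l' q', B' = p' ++ l' :: q' ∧ l'.1 = l.1 ∧
      ∀ m, (m ∈ C ∨ m ∈ p ∨ inv m ∈ q) ↔ (m ∈ C' ∨ m ∈ p' ∨ inv m ∈ q') :=
  exists_split_of_pair_frame ((h.pair_frame he hc).of_holdsB0 hB)

/-- The outer part of a reduced frame is the intersection of the sets that belong to the first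
and the last letter of the middle part. -/
theorem Reduced.subset {C B C' B' : List Letter} (h : Reduced C B)
    (hB : HoldsB0 (frame C B) (frame C' B')) : ∀ m ∈ C', m ∈ C := by
  intro m hm
  obtain ⟨l, R, he, hl⟩ := h.first
  obtain ⟨k, S, he', hk⟩ := h.last
  obtain ⟨_, _, _, -, -, h1⟩ := h.transfer hB [] l R he ⟨by simp, hl, by simp⟩
  obtain ⟨_, _, _, -, -, h2⟩ := h.transfer hB S k [] he' ⟨hk, by simp, by simp⟩
  have h1 := (h1 m).2 (Or.inl hm)
  have h2 := (h2 m).2 (Or.inl hm)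
  simp only [List.not_mem_nil, false_or, or_false] at h1 h2
  rcases h1 with h1 | h1
  · exact h1
  rcases h2 with h2 | h2
  · exact h2
  exact absurd (by rw [he]; simp [h1]) (h.right m (by rw [he']; simp [h2]))

theorem weq_frame_congr {C C' B B' : List Letter} (hC : ∀ l, l ∈ C ↔ l ∈ C') (hB : WEq B B') :
    WEq (frame C B) (frame C' B') := by
  intro M _ _ _ φ hφ
  rw [val_frame, val_frame, val_sq_congr φ hC, hB M φ hφ]

/-- Two reduced frames with the same values in `B0` are equal if their middle parts start with
the same variable, up to a star, and continue with the same letters. -/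
theorem weq_frame_of_first {C C' R q : List Letter} {l m : Letter} (h : Reduced C (l :: R))
    (h' : Reduced C' (m :: q)) (hB : HoldsB0 (frame C (l :: R)) (frame C' (m :: q)))
    (hlm : m.1 = l.1) (hRq : ∀ k, k ∈ R ↔ k ∈ q) :
    WEq (frame C (l :: R)) (frame C' (m :: q)) := by
  have hC : ∀ k, k ∈ C ↔ k ∈ C' := fun k => ⟨h'.subset hB.symm k, h.subset hB k⟩
  cases R with
  | nil =>
    obtain rfl : q = [] := List.eq_nil_iff_forall_not_mem.2 fun k hk => by
      simpa using (hRq k).2 hk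
    rcases eq_or_eq_inv hlm with rfl | rfl
    · exact weq_frame_congr hC (WEq.refl _)
    · exact (weq_frame_winv h.ne_nil _).trans (weq_frame_congr hC (by simpa using WEq.refl _))
  | cons a R =>
    -- the last letter shows that the first letters agree
    have hm : m = l := by
      obtain ⟨k, S, he, hk⟩ := h.last
      obtain ⟨p', k', q', he', hk', hK⟩ := h.transfer hB S k [] he ⟨hk, by simp, by simp⟩
      have hkR : k ∈ a :: R := by
        have := congrArg List.getLast? he
        simp only [List.getLast?_cons_cons, List.getLast?_append, List.getLast?_singleton,
          Option.some_or] at this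
        exact List.mem_of_getLast? this
      cases p' with
      | nil =>
        simp only [List.nil_append, List.cons.injEq] at he'
        obtain ⟨l₁, R₁, he₁, hl₁⟩ := h.first
        obtain ⟨rfl, rfl⟩ := List.cons.inj he₁
        have : k.1 = l.1 := by rw [← hk', ← he'.1, hlm]
        rcases eq_or_eq_inv this with rfl | rfl
        · exact absurd hkR hl₁
        · exact absurd (List.mem_cons_of_mem _ hkR) (h.right l (by simp))
      | cons b p' =>
        obtain ⟨rfl, -⟩ := List.cons.inj he'
        rcases (hK m).2 (Or.inr (Or.inl (by simp))) with h1 | h1 | h1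
        · exact absurd ((hC m).1 h1) fun h1 => (h'.disj m h1).1 (by simp)
        · rcases eq_or_eq_inv hlm with h2 | h2
          · exact h2
          · exact absurd (by rw [he, ← h2]; simp [h1]) (h.right l (by simp))
        · simp at h1
    subst hm
    have hmem : ∀ k, k ∈ m :: a :: R ↔ k ∈ m :: q := fun k => by
      rw [List.mem_cons (l := a :: R), List.mem_cons (l := q), hRq]
    refine weq_frame_congr hC (weq_of_cutsLe _ _ _ le_rfl hmem ?_ ?_)
    · refine cutsLe_of_pairs h.right hmem h.disj fun p l q he hc => ?_
      obtain ⟨p', l', q', h1, h2, h3⟩ := h.transfer hB p l q he hc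
      exact ⟨p', l', q', h1, h2, fun k => by rw [h3 k, hC]⟩
    · refine cutsLe_of_pairs h'.right (fun k => (hmem k).symm) h'.disj fun p l q he hc => ?_
      obtain ⟨p', l', q', h1, h2, h3⟩ := h'.transfer hB.symm p l q he hc
      exact ⟨p', l', q', h1, h2, fun k => by rw [h3 k, hC]⟩

/-- If two reduced frames have the same values in `B0`, then the first letter of one middle part
is, up to stars, the first or the last letter of the other one. -/
theorem Reduced.first_or_last {C B C' p q : List Letter} {l m : Letter} {R : List Letter}
    (h : Reduced C B) (h' : Reduced C' (p ++ m :: q)) (he : B = l :: R)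
    (hB : HoldsB0 (frame C B) (frame C' (p ++ m :: q))) (hlm : m.1 = l.1)
    (hRpq : ∀ k, (k ∈ C ∨ inv k ∈ R) ↔ (k ∈ C' ∨ k ∈ p ∨ inv k ∈ q)) : p = [] ∨ q = [] := by
  have hC : ∀ k, k ∈ C ↔ k ∈ C' := fun k => ⟨h'.subset hB.symm k, h.subset hB k⟩
  by_contra! hpq
  -- a letter `a ≠ m` of the other middle part that is a cut comes after `l` in `B`
  have key : ∀ u a v, p ++ m :: q = u ++ a :: v → IsCut u a v → a.1 ≠ l.1 →
      l ∈ u ∨ inv l ∈ v := by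
    intro u a v hu hc ha
    obtain ⟨u', a', v', h1, h2, h3⟩ := h'.transfer hB.symm u a v hu hc
    cases u' with
    | nil =>
      rw [he] at h1
      obtain ⟨rfl, -⟩ := List.cons.inj h1
      exact absurd h2.symm ha
    | cons b u' =>
      rw [he] at h1
      obtain ⟨rfl, -⟩ := List.cons.inj h1
      rcases (h3 l).2 (Or.inr (Or.inl (by simp))) with h4 | h4
      · exact absurd (by simp [he]) (h.disj l ((hC l).2 h4)).1
      · exact h4
  obtain ⟨a, A, hA, haA⟩ := h'.first
  obtain ⟨b, A', hA', hbA⟩ := h'.last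
  -- the variable of `l` occurs in the other middle part only as `m`
  have hl1 : ∀ k ∈ R, k.1 ≠ l.1 := by
    intro k hk hkl
    obtain ⟨l₁, R₁, he₁, hl₁⟩ := h.first
    obtain ⟨rfl, rfl⟩ := List.cons.inj (he.symm.trans he₁)
    rcases eq_or_eq_inv hkl with rfl | rfl
    · exact hl₁ hk
    · exact h.right l (by simp [he]) (by simp [he, hk])
  have hp1 : ∀ k ∈ p, k.1 ≠ l.1 := by
    intro k hk
    rcases (hRpq k).2 (Or.inr (Or.inl hk)) with h1 | h1
    · exact absurd (by simp [hk]) (h'.disj k ((hC k).1 h1)).1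
    · exact hl1 (inv k) h1
  have hq1 : ∀ k ∈ q, k.1 ≠ l.1 := by
    intro k hk
    rcases (hRpq (inv k)).2 (Or.inr (Or.inr (by simpa using hk))) with h1 | h1
    · have := (h'.disj _ ((hC _).1 h1)).2
      rw [inv_inv] at this
      exact absurd (by simp [hk]) this
    · rw [inv_inv] at h1; exact hl1 _ h1
  have e1 : inv l = m := by
    cases p with
    | nil => exact absurd rfl hpq.1
    | cons c p =>
      have hA2 := hA
      simp only [List.cons_append, List.cons.injEq] at hA2
      obtain ⟨rfl, hA2⟩ := hA2
      have := key [] c A hA ⟨by simp, haA, by simp⟩ (hp1 c (by simp))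
      rw [← hA2] at this
      simp only [List.not_mem_nil, false_or, List.mem_append, List.mem_cons] at this
      rcases this with h1 | h1 | h1
      · exact absurd rfl (hp1 (inv l) (by simp [h1]))
      · exact h1
      · exact absurd rfl (hq1 (inv l) h1)
  have e2 : l = m := by
    rcases q.eq_nil_or_concat with h0 | ⟨q₀, c, rfl⟩
    · exact absurd h0 hpq.2
    · rw [List.concat_eq_append] at *
      have hA2 : p ++ m :: q₀ = A' ∧ c = b := by
        have : (p ++ m :: q₀) ++ [c] = A' ++ [b] := by rw [← hA']; simp
        simpa using List.append_inj' this rfl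
      obtain ⟨rfl, rfl⟩ := hA2
      have := key _ c [] hA' ⟨hbA, by simp, by simp⟩ (hq1 c (by simp))
      simp only [List.not_mem_nil, or_false, List.mem_append, List.mem_cons] at this
      rcases this with h1 | h1 | h1
      · exact absurd rfl (hp1 _ h1)
      · exact h1
      · exact absurd rfl (hq1 _ (by simp [h1]))
  exact inv_ne l (e1.trans e2.symm)

theorem weq_of_reduced {C B C' B' : List Letter} (h : Reduced C B) (h' : Reduced C' B')
    (hB : HoldsB0 (frame C B) (frame C' B')) : WEq (frame C B) (frame C' B') := by
  have hC : ∀ k, k ∈ C ↔ k ∈ C' := fun k => ⟨h'.subset hB.symm k, h.subset hB k⟩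
  obtain ⟨l, R, rfl, hl⟩ := h.first
  obtain ⟨p, m, q, rfl, hlm, hK⟩ := h.transfer hB [] l R rfl ⟨by simp, hl, by simp⟩
  simp only [List.not_mem_nil, false_or] at hK
  have hR : ∀ k, k ∈ C → inv k ∉ R := fun k hk h1 => (h.disj k hk).2 (by simp [h1])
  rcases h.first_or_last h' rfl hB hlm hK with rfl | rfl
  · refine weq_frame_of_first h h' hB hlm fun k => ?_
    have h1 := hK (inv k)
    have h2 := hR (inv k)
    have h3 : inv k ∈ C' → inv (inv k) ∉ q := fun hk h1 =>
      (h'.disj _ hk).2 (List.mem_cons_of_mem _ h1)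
    have h4 := hC (inv k)
    simp only [inv_inv, List.not_mem_nil, false_or] at h1 h2 h3
    tauto
  · -- replacing the middle part by its star moves the last letter to the front
    have h1 := weq_frame_winv h'.ne_nil (p ++ [m])
    have h2 := h'.winv
    rw [show winv (p ++ [m]) = inv m :: winv p by simp] at h1 h2
    refine WEq.trans (weq_frame_of_first h h2 (hB.trans h1.holdsB0) hlm fun k => ?_) h1.symm
    have h1 := hK (inv k)
    have h2 := hR (inv k)
    have h3 : inv k ∈ C' → inv k ∉ p := fun hk h1 => (h'.disj _ hk).1 (by simp [h1])
    have h4 := hC (inv k)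
    simp only [inv_inv, List.not_mem_nil, or_false, mem_winv] at h1 h2 h3 ⊢
    tauto

theorem not_pair_zeroWord (n : ℕ) (K : Set Letter) : ¬ Pair zeroWord n K := by
  rintro ⟨p, l, q, he, hl, hp, hq, -⟩
  have hcount : zeroWord.countP (fun m => m.1 = n) = 1 := by
    rw [he, List.countP_append, List.countP_cons, List.countP_eq_zero.2, List.countP_eq_zero.2]
    · simp [hl]
    · simpa using fun a b hm => hq (a, b) hm
    · simpa using fun a b hm => hp (a, b) hm
  simp only [zeroWord, List.countP_cons, List.countP_nil] at hcount
  split_ifs at hcount <;> omega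

theorem Reduced.not_holdsB0_zeroWord {C B : List Letter} (h : Reduced C B) :
    ¬ HoldsB0 (frame C B) zeroWord := by
  intro h0
  obtain ⟨l, R, he, hl⟩ := h.first
  exact not_pair_zeroWord _ _ ((h.pair_frame (p := []) he ⟨by simp, hl, by simp⟩).of_holdsB0 h0)

/-- The identities of `B0` between words follow from those of `basisB0`. -/
theorem weq_of_holdsB0 {u v : List Letter} (hu : u ≠ []) (hv : v ≠ []) (h : HoldsB0 u v) :
    WEq u v := by
  by_cases hun : NonMixed u
  · exact weq_of_nonMixed hun hu hv h
  by_cases hvn : NonMixed v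
  · exact (weq_of_nonMixed hvn hv hu h.symm).symm
  rcases mixed_reduce hun with h1 | ⟨C, B, h1, h2⟩ <;>
    rcases mixed_reduce hvn with h3 | ⟨C', B', h3, h4⟩
  · exact h1.trans h3.symm
  · exact absurd ((h4.symm.holdsB0.trans h.symm).trans h1.holdsB0) h3.not_holdsB0_zeroWord
  · exact absurd ((h2.symm.holdsB0.trans h).trans h3.holdsB0) h1.not_holdsB0_zeroWord
  · exact h2.trans ((weq_of_reduced h1 h3
      ((h2.symm.holdsB0.trans h).trans h4.holdsB0)).trans h4.symm)

theorem isIdentityBasis_basisB0 : IsIdentityBasis B0 basisB0 := by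
  refine ⟨B0.satisfies_basis, ?_⟩
  rintro ⟨s, t⟩ h
  refine deducible_of_weq (weq_of_holdsB0 s.word_ne_nil t.word_ne_nil fun φ => ?_)
  rw [bval, bval, val_word, val_word, h φ]

theorem finite_basisB0 : basisB0.Finite := by
  simp only [basisB0, involutionIdentities, mixedIdentities, Set.finite_union,
    Set.finite_insert, Set.finite_singleton, and_self]

theorem card_B0 : Nat.card B0 = 4 := by
  let e : B0 ≃ Fin 4 :=
    { toFun := fun a => match a with
        | .e1 => 0 | .e2 => 1 | .e3 => 2 | .e4 => 3
      invFun := fun n => match n with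
        | 0 => .e1 | 1 => .e2 | 2 => .e3 | 3 => .e4
      left_inv := by rintro (_ | _ | _ | _) <;> rfl
      right_inv := by intro n; fin_cases n <;> rfl }
  rw [Nat.card_congr e, Nat.card_fin]

end InvSemi

/-- The involution semigroup `(B₀, *)` has order four, the finite set `basisB0` of identities is
an identity basis of it, and hence it is finitely based. -/
theorem theorem5p1 :
    Nat.card InvSemi.B0 = 4 ∧
    InvSemi.basisB0.Finite ∧
    InvSemi.IsIdentityBasis InvSemi.B0 InvSemi.basisB0 ∧
    InvSemi.FinitelyBased InvSemi.B0 := by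
  exact ⟨InvSemi.card_B0, InvSemi.finite_basisB0, InvSemi.isIdentityBasis_basisB0,
    _, InvSemi.finite_basisB0, InvSemi.isIdentityBasis_basisB0⟩
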